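/- Let $d\ge 2$, let $S^{d-1}\subset\mathbb R^d$ be the unit sphere, and let $\mu$ be a uniform measure on it, i.e. a positive constant multiple of the surface measure. For $x\in S^{d-1}$ and $R>0$ put $B(x,R)=\{y\in S^{d-1}:\|x-y\|\le R\}$ (Euclidean norm), let $0<r\le 2$ and $r_s>0$, let $k(x,y)=\mathbf 1(\|x-y\|\le r)$, and let $\phi(R)=\arccos(1-R^2/2)$ for $0<R\le 2$ be the arc length between two points of the sphere at Euclidean distance $R$ (and $\phi(R)=\pi$ for $R>2$). Then all balls $B(x,r)$, $x\in S^{d-1}$, have the same volume $a=\mu(B(x,r))>0$, and there is a constant $\Gamma_0\in(0,a]$, depending only on $d,\mu,r,r_s$, such that the following holds for every source landmark $x_s\in S^{d-1}$ and every ground weight $\rho>0$. 1. (Existence and uniqueness) There is exactly one measurable map $\lambda:S^{d-1}\to[0,1]$ with $\lambda(x)=1$ for $x\in B(x_s,r_s)$ and $$\lambda(x)=\frac{\int_{B(x_s,r_s)}k(x,y)\,d\mu(y)+\int_{S^{d-1}\setminus B(x_s,r_s)}k(x,y)\lambda(y)\,d\mu(y)}{\rho+a}\qquad\text{for } x\notin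 B(x_s,r_s).$$ 2. (Radial symmetry and monotonicity) There is a function $h$ with $\lambda(x)=h(\arccos\langle x_s,x\rangle)$ for all $x\in S^{d-1}$; on $[0,\pi]$, and in particular outside the source, $h$ is monotonically decreasing (non-increasing). 3. (Upper bound) For all real $t\ge 1$ and $z\ge 2r$ with $z+t\phi(r)\le\pi$, if $r_s\le r$ or $z\ge\phi(r_s)+\phi(r)$, then $$h(z+t\phi(r))\le \exp\bigl(-t\ln(1+2\rho/a)\bigr).$$ 4. (Lower bound) There is a constant $\Gamma\in(0,a]$ (which may depend on $\rho$) such that for all real $t\ge1$ and $z\ge0$ with $z+t\phi(r/2)\le\pi$, $$h(z+t\phi(r/2))\ge\exp\bigl(-t\ln((a+\rho)/\Gamma)\bigr).$$ For $0\le z\le\phi(r_s)$ (starting distance in the source) the same bound holds with $\Gamma_0$, which does not depend on $\rho$, in place of $\Gamma$. -/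

import Mathlib

open MeasureTheory Metric Set

noncomputable section

namespace GroundedVoltage

/-- The unit sphere `S^{d-1}` of `ℝ^d`; its metric is the Euclidean (chordal) distance. -/
abbrev UnitSphere (d : ℕ) : Type :=
  sphere (0 : EuclideanSpace ℝ (Fin d)) 1

/-- The uniform measure on `S^{d-1}`: the surface measure, multiplied by a normalising constant
`c` (`c = 1` is the Lebesgue surface measure, and the reciprocal of the total surface area gives
the uniform probability measure). -/
def uniformMeasure (d : ℕ) (c : NNReal) : Measure (UnitSphere d) :=
  c • (volume : Measure (EuclideanSpace ℝ (Fin d))).toSphere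

/-- The radial (disk) kernel `k(x, y) = 1(‖x - y‖ ≤ r)`. -/
def radialKernel {M : Type*} [PseudoMetricSpace M] (r : ℝ) (x y : M) : ℝ :=
  {p : M × M | dist p.1 p.2 ≤ r}.indicator 1 (x, y)

/-- The geodesic distance `arccos ⟨x, y⟩` on the unit sphere. -/
def geoDist {d : ℕ} (x y : UnitSphere d) : ℝ :=
  Real.arccos (inner ℝ (x : EuclideanSpace ℝ (Fin d)) (y : EuclideanSpace ℝ (Fin d)))

/-- `φ(r)`: the arc length between two points of the unit sphere at Euclidean distance `r`
(for `0 ≤ r ≤ 2`). -/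
def arcLength (r : ℝ) : ℝ :=
  Real.arccos (1 - r ^ 2 / 2)

theorem geoDist_eq_arcLength {d : ℕ} (x y : UnitSphere d) :
    geoDist x y = arcLength (dist x y) := by
  have hx : ‖(x : EuclideanSpace ℝ (Fin d))‖ = 1 := norm_eq_of_mem_sphere x
  have hy : ‖(y : EuclideanSpace ℝ (Fin d))‖ = 1 := norm_eq_of_mem_sphere y
  have h := norm_sub_sq_real (x : EuclideanSpace ℝ (Fin d)) (y : EuclideanSpace ℝ (Fin d))
  rw [hx, hy] at h
  unfold geoDist arcLength
  rw [Subtype.dist_eq, dist_eq_norm, h]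
  congr 1
  ring

/-- `lam : S^{d-1} → [0, 1]` is a (measurable) grounded voltage function for the uniform measure
`uniformMeasure d c`, the radial kernel of radius `r`, the source ball `B(xs, rs)` and the ground
weight `ρ`, where `a` is the volume of a ball of radius `r` in the sphere: it is `1` on the source,
and elsewhere it satisfies the averaging equation. -/
structure IsVoltage (d : ℕ) (c : NNReal) (xs : UnitSphere d) (r rs ρ a : ℝ)
    (lam : UnitSphere d → ℝ) : Prop where
  measurable : Measurable lam
  mem_Icc : ∀ x, lam x ∈ Icc (0 : ℝ) 1
  eq_one : ∀ x ∈ closedBall xs rs, lam x = 1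
  eq_average : ∀ x ∉ closedBall xs rs,
    lam x = ((∫ y in closedBall xs rs, radialKernel r x y ∂(uniformMeasure d c)) +
      ∫ y in (closedBall xs rs)ᶜ, radialKernel r x y * lam y ∂(uniformMeasure d c)) / (ρ + a)

end GroundedVoltage

end

/-!
The sphere is treated as a homogeneous metric measure space: linear isometries preserve the uniform
measure, so all balls of a given radius have the same volume `a`, and off the source the voltage
equation says that `(ρ + a) * lam x` is the integral of `lam` over the ball `B(x, r)`.

*Existence and uniqueness.* Relaxation, started from `0`, increases to a solution
(`exists_isBallVoltage`). Since each averaging multiplies defects by at most `a / (ρ + a) < 1`,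
every solution lies below every nonnegative supersolution (`IsBallVoltage.le_of_supersolution`);
applied to two solutions this is uniqueness.

*Radial monotonicity.* Being a decreasing function of the distance to `xs` survives relaxation,
hence holds in the limit. The point is that the ball integral of such an `f` is again decreasing
(`setIntegral_closedBall_le_of_geoDist_le`): if `σ` is the reflection exchanging the centres `x` and
`x'`, the difference of the ball integrals at `x` and `x'` is half the integral of
`(𝟙_{B(x, r)} - 𝟙_{B(x', r)}) * (f - f ∘ σ)`, and both factors are nonnegative on the side of `x`
and nonpositive on the side of `x'`.

*Upper bound.* Put `φ = φ(r)`, `L = log (1 + 2 * ρ / a)`, and let `ψ` be the distance to the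
antipode of the source. Then `exp (L * max (ψ / φ - 3 / 4) 0)` is a supersolution on the whole
sphere (`setIntegral_exp_stepCount_le`). Indeed the points of `B(x, r)` come in pairs, exchanged by
the reflection in the axis through `x`; the distances `α`, `β` of a pair at distance `ω` from `x`
satisfy `cos α + cos β = 2 * cos ω * cos ψ`, from which `(α + β) / 2 ≤ max ψ (3 φ / 4) + φ / 2`
(`half_add_le_max`), and convexity of the exponential does the rest. The truncation near the
antipode is needed because there a step increases the mean distance by more than `φ / 2` in high
dimension. The assumption on `z` leaves a margin of `3 φ / 4` beyond the source, which pays for the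
truncation.

*Lower bound.* As `2 * φ(r / 2) < φ(r)`, a ball of radius `r` centred off the source contains a
small ball, of a radius `R` depending on `r` and `rs` only, all of whose points are closer to the
source by `2 * φ(r / 2)` or lie in it. Hence `Γ₀ / (a + ρ)`, where `Γ₀` is at most the volume of the
small ball, bounds the decay over a distance `2 * φ(r / 2)` (`IsBallVoltage.pow_le`), and `⌊t⌋₊`
such steps suffice because `t ≤ 2 * ⌊t⌋₊` for `t ≥ 1`. In particular the voltage is positive at the
antipode, where it is least; this gives the bound for arbitrary `z`.
-/

noncomputable section

namespace GroundedVoltage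

open scoped RealInnerProductSpace Pointwise

/-! ### Geometry of the sphere -/

section Geometry

variable {d : ℕ}

theorem inner_mem_Icc (x y : UnitSphere d) :
    ⟪(x : EuclideanSpace ℝ (Fin d)), y⟫ ∈ Icc (-1 : ℝ) 1 := by
  have h := abs_real_inner_le_norm (x : EuclideanSpace ℝ (Fin d)) (y : EuclideanSpace ℝ (Fin d))
  rw [norm_eq_of_mem_sphere, norm_eq_of_mem_sphere, one_mul] at h
  exact abs_le.1 h

theorem geoDist_nonneg (x y : UnitSphere d) : 0 ≤ geoDist x y := Real.arccos_nonneg _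

theorem geoDist_le_pi (x y : UnitSphere d) : geoDist x y ≤ Real.pi := Real.arccos_le_pi _

theorem geoDist_comm (x y : UnitSphere d) : geoDist x y = geoDist y x := by
  unfold geoDist; rw [real_inner_comm]

theorem cos_geoDist (x y : UnitSphere d) :
    Real.cos (geoDist x y) = ⟪(x : EuclideanSpace ℝ (Fin d)), y⟫ :=
  Real.cos_arccos (inner_mem_Icc x y).1 (inner_mem_Icc x y).2

theorem geoDist_le_geoDist_iff {x y x' y' : UnitSphere d} :
    geoDist x y ≤ geoDist x' y' ↔
      ⟪(x' : EuclideanSpace ℝ (Fin d)), y'⟫ ≤ ⟪(x : EuclideanSpace ℝ (Fin d)), y⟫ := by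
  rw [← cos_geoDist, ← cos_geoDist]
  exact (Real.strictAntiOn_cos.le_iff_ge ⟨geoDist_nonneg _ _, geoDist_le_pi _ _⟩
    ⟨geoDist_nonneg _ _, geoDist_le_pi _ _⟩).symm

theorem geoDist_triangle (x y z : UnitSphere d) :
    geoDist x z ≤ geoDist x y + geoDist y z := by
  have h := InnerProductGeometry.angle_le_angle_add_angle
    (x : EuclideanSpace ℝ (Fin d)) (y : EuclideanSpace ℝ (Fin d)) (z : EuclideanSpace ℝ (Fin d))
  simpa [InnerProductGeometry.angle, geoDist] using h

theorem continuous_geoDist (x : UnitSphere d) : Continuous (geoDist x) := by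
  unfold geoDist
  fun_prop

theorem dist_sq_eq (x y : UnitSphere d) :
    dist x y ^ 2 = 2 - 2 * ⟪(x : EuclideanSpace ℝ (Fin d)), y⟫ := by
  have h := norm_sub_sq_real (x : EuclideanSpace ℝ (Fin d)) (y : EuclideanSpace ℝ (Fin d))
  rw [norm_eq_of_mem_sphere, norm_eq_of_mem_sphere] at h
  rw [Subtype.dist_eq, dist_eq_norm, h]
  ring

/-- For `R > 2`, where `arccos` is truncated, `arcLength R = π` and both sides hold always. -/
theorem dist_le_iff_geoDist_le {R : ℝ} (hR : 0 ≤ R) (x y : UnitSphere d) :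
    dist x y ≤ R ↔ geoDist x y ≤ arcLength R := by
  have hi := inner_mem_Icc x y
  have hd := dist_sq_eq x y
  rcases le_total R 2 with h2 | h2
  · have hR' : 1 - R ^ 2 / 2 ∈ Icc (-1 : ℝ) 1 := ⟨by nlinarith, by nlinarith⟩
    unfold geoDist arcLength
    rw [Real.strictAntiOn_arccos.le_iff_ge hi hR', ← sq_le_sq₀ dist_nonneg hR, hd]
    constructor <;> intro h <;> linarith
  · have h1 : arcLength R = Real.pi := by
      unfold arcLength
      exact Real.arccos_of_le_neg_one (by nlinarith)
    rw [h1]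
    refine iff_of_true ?_ (geoDist_le_pi _ _)
    rw [← sq_le_sq₀ dist_nonneg hR, hd]
    nlinarith [hi.1]

theorem mem_closedBall_iff_geoDist_le {R : ℝ} (hR : 0 ≤ R) (x y : UnitSphere d) :
    y ∈ closedBall x R ↔ geoDist x y ≤ arcLength R := by
  rw [mem_closedBall', dist_le_iff_geoDist_le hR]

theorem arcLength_pos {R : ℝ} (hR : 0 < R) : 0 < arcLength R := by
  unfold arcLength
  rw [Real.arccos_pos]
  have := pow_pos hR 2
  linarith

/-- In dimension at least two every angle is realised: the great circle through `x` in some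
direction is parametrised by arc length. -/
theorem exists_greatCircle (hd : 2 ≤ d) (x : UnitSphere d) :
    ∃ γ : ℝ → UnitSphere d, γ 0 = x ∧
      ∀ s t, ⟪(γ s : EuclideanSpace ℝ (Fin d)), γ t⟫ = Real.cos (s - t) := by
  obtain ⟨e, he, hxe⟩ : ∃ e : EuclideanSpace ℝ (Fin d), ‖e‖ = 1 ∧
      ⟪(x : EuclideanSpace ℝ (Fin d)), e⟫ = 0 := by
    have hfin : 1 < Module.finrank ℝ (EuclideanSpace ℝ (Fin d)) := by
      rw [finrank_euclideanSpace_fin]; omega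
    have hne : (ℝ ∙ (x : EuclideanSpace ℝ (Fin d)))ᗮ ≠ ⊥ := by
      intro hbot
      rw [Submodule.orthogonal_eq_bot_iff] at hbot
      have := finrank_span_le_card (R := ℝ) ({(x : EuclideanSpace ℝ (Fin d))} : Set _)
      rw [hbot, finrank_top] at this
      simp at this
      omega
    obtain ⟨v, hv, hv0⟩ := Submodule.exists_mem_ne_zero_of_ne_bot hne
    refine ⟨(‖v‖)⁻¹ • v, by rw [norm_smul, norm_inv, norm_norm,
      inv_mul_cancel₀ (norm_ne_zero_iff.2 hv0)], ?_⟩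
    rw [inner_smul_right, Submodule.mem_orthogonal_singleton_iff_inner_right.1 hv, mul_zero]
  have hin : ∀ s t, ⟪Real.cos s • (x : EuclideanSpace ℝ (Fin d)) + Real.sin s • e,
      Real.cos t • (x : EuclideanSpace ℝ (Fin d)) + Real.sin t • e⟫ = Real.cos (s - t) := by
    intro s t
    have hex : ⟪e, (x : EuclideanSpace ℝ (Fin d))⟫ = 0 := by rw [real_inner_comm, hxe]
    simp only [inner_add_left, inner_add_right, real_inner_smul_left, real_inner_smul_right,
      hxe, hex, real_inner_self_eq_norm_sq, he, norm_eq_of_mem_sphere]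
    rw [Real.cos_sub]
    ring
  refine ⟨fun s ↦ ⟨Real.cos s • (x : EuclideanSpace ℝ (Fin d)) + Real.sin s • e, ?_⟩, ?_, hin⟩
  · rw [mem_sphere_zero_iff_norm, ← sq_eq_sq₀ (norm_nonneg _) zero_le_one,
      ← real_inner_self_eq_norm_sq, hin]
    simp
  · ext1; simp

theorem geoDist_greatCircle {γ : ℝ → UnitSphere d}
    (hγ : ∀ s t, ⟪(γ s : EuclideanSpace ℝ (Fin d)), γ t⟫ = Real.cos (s - t))
    {s t : ℝ} (hst : s ≤ t) (ht : t - s ≤ Real.pi) : geoDist (γ s) (γ t) = t - s := by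
  unfold geoDist
  rw [hγ, ← Real.cos_neg, neg_sub, Real.arccos_cos (by linarith) ht]

/-! ### Isometries of the sphere -/

/-- The self-map of the unit sphere induced by a linear isometry of the ambient space. -/
def sphereMap (g : EuclideanSpace ℝ (Fin d) ≃ₗᵢ[ℝ] EuclideanSpace ℝ (Fin d)) (x : UnitSphere d) :
    UnitSphere d :=
  ⟨g x, by rw [mem_sphere_zero_iff_norm, g.norm_map, norm_eq_of_mem_sphere]⟩

theorem inner_sphereMap (g : EuclideanSpace ℝ (Fin d) ≃ₗᵢ[ℝ] EuclideanSpace ℝ (Fin d))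
    (x y : UnitSphere d) :
    ⟪(sphereMap g x : EuclideanSpace ℝ (Fin d)), sphereMap g y⟫ =
      ⟪(x : EuclideanSpace ℝ (Fin d)), y⟫ :=
  g.inner_map_map _ _

theorem geoDist_sphereMap (g : EuclideanSpace ℝ (Fin d) ≃ₗᵢ[ℝ] EuclideanSpace ℝ (Fin d))
    (x y : UnitSphere d) : geoDist (sphereMap g x) (sphereMap g y) = geoDist x y := by
  unfold geoDist
  rw [inner_sphereMap]

theorem dist_sphereMap (g : EuclideanSpace ℝ (Fin d) ≃ₗᵢ[ℝ] EuclideanSpace ℝ (Fin d))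
    (x y : UnitSphere d) : dist (sphereMap g x) (sphereMap g y) = dist x y :=
  g.dist_map _ _

theorem continuous_sphereMap (g : EuclideanSpace ℝ (Fin d) ≃ₗᵢ[ℝ] EuclideanSpace ℝ (Fin d)) :
    Continuous (sphereMap g) :=
  Continuous.subtype_mk (g.continuous.comp continuous_subtype_val) _

instance (c : NNReal) : IsFiniteMeasure (uniformMeasure d c) := by
  unfold uniformMeasure; infer_instance

theorem measurePreserving_sphereMap (c : NNReal)
    (g : EuclideanSpace ℝ (Fin d) ≃ₗᵢ[ℝ] EuclideanSpace ℝ (Fin d)) :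
    MeasurePreserving (sphereMap g) (uniformMeasure d c) (uniformMeasure d c) := by
  have hm : Measurable (sphereMap g) := (continuous_sphereMap g).measurable
  refine MeasurePreserving.smul_measure (c := c) ⟨hm, ?_⟩
  ext s hs
  rw [Measure.map_apply hm hs, Measure.toSphere_apply' _ hs, Measure.toSphere_apply' _ (hm hs)]
  congr 1
  have hset : (Ioo (0 : ℝ) 1 • ((↑) '' (sphereMap g ⁻¹' s)) : Set (EuclideanSpace ℝ (Fin d))) =
      g ⁻¹' (Ioo (0 : ℝ) 1 • ((↑) '' s)) := by
    ext y
    simp only [mem_preimage, mem_smul, mem_image]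
    constructor
    · rintro ⟨t, ht, _, ⟨u, hu, rfl⟩, rfl⟩
      exact ⟨t, ht, _, ⟨_, hu, rfl⟩, by simp [sphereMap]⟩
    · rintro ⟨t, ht, _, ⟨u, hu, rfl⟩, hy⟩
      refine ⟨t, ht, _, ⟨sphereMap g.symm u, ?_, rfl⟩, ?_⟩
      · convert hu using 1
        ext1
        simp [sphereMap]
      · apply g.injective
        rw [← hy]
        simp [sphereMap]
  rw [hset]
  exact MeasurePreserving.measure_preimage_equiv
    (f := g.toHomeomorph.toMeasurableEquiv) g.measurePreserving _

theorem sphereMap_preimage_closedBall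
    (g : EuclideanSpace ℝ (Fin d) ≃ₗᵢ[ℝ] EuclideanSpace ℝ (Fin d)) (x : UnitSphere d) (r : ℝ) :
    sphereMap g ⁻¹' closedBall (sphereMap g x) r = closedBall x r := by
  ext y
  rw [mem_preimage, mem_closedBall, mem_closedBall, dist_sphereMap]

theorem measurableEmbedding_sphereMap
    (g : EuclideanSpace ℝ (Fin d) ≃ₗᵢ[ℝ] EuclideanSpace ℝ (Fin d)) :
    MeasurableEmbedding (sphereMap g) :=
  (Isometry.of_dist_eq (dist_sphereMap g)).isClosedEmbedding.measurableEmbedding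

theorem setIntegral_comp_sphereMap (c : NNReal)
    (g : EuclideanSpace ℝ (Fin d) ≃ₗᵢ[ℝ] EuclideanSpace ℝ (Fin d)) (f : UnitSphere d → ℝ)
    (x : UnitSphere d) (r : ℝ) :
    ∫ y in closedBall x r, f (sphereMap g y) ∂uniformMeasure d c =
      ∫ y in closedBall (sphereMap g x) r, f y ∂uniformMeasure d c := by
  rw [← sphereMap_preimage_closedBall g]
  exact (measurePreserving_sphereMap c g).setIntegral_preimage_emb
    (measurableEmbedding_sphereMap g) _ _

/-- The sphere is homogeneous under reflections. -/
theorem exists_sphereMap_eq (x x' : UnitSphere d) :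
    ∃ g : EuclideanSpace ℝ (Fin d) ≃ₗᵢ[ℝ] EuclideanSpace ℝ (Fin d), sphereMap g x = x' :=
  ⟨(ℝ ∙ ((x : EuclideanSpace ℝ (Fin d)) - x'))ᗮ.reflection, Subtype.ext <|
    Submodule.reflection_sub (by rw [norm_eq_of_mem_sphere, norm_eq_of_mem_sphere])⟩

theorem measure_closedBall_eq (c : NNReal) (r : ℝ) (x x' : UnitSphere d) :
    (uniformMeasure d c).real (closedBall x r) = (uniformMeasure d c).real (closedBall x' r) := by
  obtain ⟨g, rfl⟩ := exists_sphereMap_eq x x'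
  rw [← (measurePreserving_sphereMap c g).measureReal_preimage (s := closedBall (sphereMap g x) r)
    isClosed_closedBall.measurableSet.nullMeasurableSet, sphereMap_preimage_closedBall]

end Geometry

/-! ### The averaging equation in a homogeneous metric measure space -/

section Averaging

open Filter Topology

variable {M : Type*} [MeasurableSpace M]

theorem integrable_of_mem_Icc {μ : Measure M} [IsFiniteMeasure μ] {f : M → ℝ} (hf : Measurable f)
    (h : ∀ x, f x ∈ Icc (0 : ℝ) 1) : Integrable f μ :=
  Integrable.of_mem_Icc 0 1 hf.aemeasurable (ae_of_all _ h)

variable [PseudoMetricSpace M]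

/-- The averaging equation written with integrals over balls: `lam` is measurable with values in
`[0, 1]`, is `1` on `A`, and off `A` the multiple `(ρ + a) * lam x` is the integral of `lam` over
the ball of radius `r` about `x`. -/
structure IsBallVoltage (μ : Measure M) (r ρ a : ℝ) (A : Set M) (lam : M → ℝ) : Prop where
  measurable : Measurable lam
  mem_Icc : ∀ x, lam x ∈ Icc (0 : ℝ) 1
  eq_one : ∀ x ∈ A, lam x = 1
  eq_integral : ∀ x ∉ A, (ρ + a) * lam x = ∫ y in closedBall x r, lam y ∂μ

open Classical in
/-- One relaxation step: `1` on `A`, and the normalised ball integral of `f` off `A`. -/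
def relax (μ : Measure M) (r ρ a : ℝ) (A : Set M) (f : M → ℝ) : M → ℝ :=
  A.piecewise 1 fun x ↦ (∫ y in closedBall x r, f y ∂μ) / (ρ + a)

theorem relax_of_mem {μ : Measure M} {r ρ a : ℝ} {A : Set M} {f : M → ℝ} {x : M} (hx : x ∈ A) : relax μ r ρ a A f x = 1 :=
  by
  classical
  exact if_pos hx

theorem relax_of_notMem {μ : Measure M} {r ρ a : ℝ} {A : Set M} {f : M → ℝ} {x : M} (hx : x ∉ A) :
    relax μ r ρ a A f x = (∫ y in closedBall x r, f y ∂μ) / (ρ + a) :=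
  by
  classical
  exact if_neg hx

theorem relax_mono {μ : Measure M} {r ρ a : ℝ} {A : Set M} (hρa : 0 ≤ ρ + a) {f g : M → ℝ} (hf : Integrable f μ) (hg : Integrable g μ)
    (hfg : f ≤ g) : relax μ r ρ a A f ≤ relax μ r ρ a A g := by
  intro x
  by_cases hx : x ∈ A
  · rw [relax_of_mem hx, relax_of_mem hx]
  · rw [relax_of_notMem hx, relax_of_notMem hx]
    exact div_le_div_of_nonneg_right
      (setIntegral_mono hf.integrableOn hg.integrableOn hfg) hρa

variable {μ : Measure M} [IsFiniteMeasure μ] {r ρ a : ℝ} {A : Set M}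

/-- Comparison principle: a solution lies below every nonnegative supersolution. Each averaging
step shrinks the defect by the factor `a / (ρ + a) < 1`. -/
theorem IsBallVoltage.le_of_supersolution {lam G : M → ℝ} (h : IsBallVoltage μ r ρ a A lam)
    (hvol : ∀ x, μ.real (closedBall x r) = a) (ha : 0 ≤ a) (hρ : 0 < ρ) (hG : Integrable G μ)
    (hG0 : ∀ x, 0 ≤ G x) (hG1 : ∀ x ∈ A, 1 ≤ G x)
    (hGs : ∀ x ∉ A, ∫ y in closedBall x r, G y ∂μ ≤ (ρ + a) * G x) (x : M) : lam x ≤ G x := by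
  have hρa : 0 < ρ + a := by linarith
  have hq : 0 ≤ a / (ρ + a) := by positivity
  have hint := integrable_of_mem_Icc (μ := μ) h.measurable h.mem_Icc
  have key : ∀ n : ℕ, ∀ x, lam x - G x ≤ (a / (ρ + a)) ^ n := by
    intro n
    induction n with
    | zero => intro x; rw [pow_zero]; linarith [hG0 x, (h.mem_Icc x).2]
    | succ n ih =>
      intro x
      by_cases hx : x ∈ A
      · have := pow_nonneg hq (n + 1)
        linarith [hG1 x hx, h.eq_one x hx]
      · have h1 : ∫ y in closedBall x r, (lam y - G y) ∂μ ≤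
            ∫ _ in closedBall x r, (a / (ρ + a)) ^ n ∂μ :=
          setIntegral_mono (hint.sub hG).integrableOn (integrable_const _).integrableOn ih
        rw [setIntegral_const, hvol, smul_eq_mul,
          integral_sub hint.integrableOn hG.integrableOn, ← h.eq_integral x hx] at h1
        have h2 : (ρ + a) * (lam x - G x) ≤ a * (a / (ρ + a)) ^ n := by linarith [hGs x hx]
        rw [pow_succ', div_mul_eq_mul_div, le_div_iff₀ hρa]
        linarith
  have hlim : Tendsto (fun n : ℕ ↦ (a / (ρ + a)) ^ n) atTop (𝓝 0) :=
    tendsto_pow_atTop_nhds_zero_of_lt_one hq ((div_lt_one hρa).2 (by linarith))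
  have := ge_of_tendsto' hlim fun n ↦ key n x
  linarith

theorem IsBallVoltage.unique {lam lam' : M → ℝ} (h : IsBallVoltage μ r ρ a A lam)
    (h' : IsBallVoltage μ r ρ a A lam') (hvol : ∀ x, μ.real (closedBall x r) = a) (ha : 0 ≤ a)
    (hρ : 0 < ρ) : lam = lam' := by
  have key : ∀ {f g : M → ℝ}, IsBallVoltage μ r ρ a A f → IsBallVoltage μ r ρ a A g →
      ∀ x, f x ≤ g x := fun hf hg ↦
    hf.le_of_supersolution hvol ha hρ (integrable_of_mem_Icc hg.measurable hg.mem_Icc)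
      (fun x ↦ (hg.mem_Icc x).1) (fun x hx ↦ (hg.eq_one x hx).ge)
      (fun x hx ↦ (hg.eq_integral x hx).ge)
  exact funext fun x ↦ le_antisymm (key h h' x) (key h' h x)

theorem relax_mem_Icc (hvol : ∀ x, μ.real (closedBall x r) = a) (ha : 0 ≤ a) (hρ : 0 < ρ)
    {f : M → ℝ} (hf : Measurable f) (hI : ∀ x, f x ∈ Icc (0 : ℝ) 1) (x : M) :
    relax μ r ρ a A f x ∈ Icc (0 : ℝ) 1 := by
  by_cases hx : x ∈ A
  · simp [relax_of_mem hx]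
  · rw [relax_of_notMem hx]
    have h0 : 0 ≤ ∫ y in closedBall x r, f y ∂μ := integral_nonneg fun y ↦ (hI y).1
    have h1 : ∫ y in closedBall x r, f y ∂μ ≤ ∫ _ in closedBall x r, (1 : ℝ) ∂μ :=
      setIntegral_mono (integrable_of_mem_Icc hf hI).integrableOn
        (integrable_const _).integrableOn fun y ↦ (hI y).2
    rw [setIntegral_const, hvol, smul_eq_mul, mul_one] at h1
    exact ⟨by positivity, (div_le_one (by linarith)).2 (by linarith)⟩

variable [OpensMeasurableSpace M]

theorem measurable_setIntegral_closedBall [SecondCountableTopology M] {f : M → ℝ}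
    (hf : Measurable f) : Measurable fun x ↦ ∫ y in closedBall x r, f y ∂μ := by
  have hs : MeasurableSet {p : M × M | dist p.2 p.1 ≤ r} :=
    (isClosed_le (continuous_snd.dist continuous_fst) continuous_const).measurableSet
  have hm : StronglyMeasurable fun p : M × M ↦
      {p : M × M | dist p.2 p.1 ≤ r}.indicator (fun p ↦ f p.2) p :=
    ((hf.comp measurable_snd).indicator hs).stronglyMeasurable
  have := (hm.integral_prod_right' (ν := μ)).measurable
  convert this using 2 with x
  rw [← integral_indicator isClosed_closedBall.measurableSet]
  rfl

theorem measurable_relax [SecondCountableTopology M] (hA : MeasurableSet A) {f : M → ℝ}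
    (hf : Measurable f) : Measurable (relax μ r ρ a A f) := by
  classical
  unfold relax
  convert Measurable.piecewise hA measurable_one
    ((measurable_setIntegral_closedBall (μ := μ) (r := r) hf).div_const (ρ + a))

/-- A solution exists, as the increasing limit of the relaxation steps started at `0`. Every
monotonicity property `R x x' → f x' ≤ f x` preserved by relaxation passes to the solution. -/
theorem exists_isBallVoltage [SecondCountableTopology M] (hA : MeasurableSet A)
    (hvol : ∀ x, μ.real (closedBall x r) = a) (ha : 0 ≤ a) (hρ : 0 < ρ) (R : M → M → Prop)
    (hR : ∀ f : M → ℝ, Measurable f → (∀ x, f x ∈ Icc (0 : ℝ) 1) →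
      (∀ x x', R x x' → f x' ≤ f x) →
      ∀ x x', R x x' → relax μ r ρ a A f x' ≤ relax μ r ρ a A f x) :
    ∃ lam, IsBallVoltage μ r ρ a A lam ∧ ∀ x x', R x x' → lam x' ≤ lam x := by
  have hρa : 0 < ρ + a := by linarith
  let u : ℕ → M → ℝ := fun n ↦ (relax μ r ρ a A)^[n] 0
  have hu : ∀ n, u (n + 1) = relax μ r ρ a A (u n) := fun n ↦
    Function.iterate_succ_apply' _ _ _
  have hreg : ∀ n, Measurable (u n) ∧ (∀ x, u n x ∈ Icc (0 : ℝ) 1) ∧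
      ∀ x x', R x x' → u n x' ≤ u n x := by
    intro n
    induction n with
    | zero => exact ⟨measurable_zero, fun x ↦ by simp [u], fun x x' _ ↦ le_rfl⟩
    | succ n ih =>
      rw [hu]
      exact ⟨measurable_relax hA ih.1, relax_mem_Icc hvol ha hρ ih.1 ih.2.1, hR _ ih.1 ih.2.1 ih.2.2⟩
  have hint : ∀ n, Integrable (u n) μ := fun n ↦ integrable_of_mem_Icc (hreg n).1 (hreg n).2.1
  have hmono : Monotone u := by
    refine monotone_nat_of_le_succ fun n ↦ ?_
    induction n with
    | zero => exact fun x ↦ ((hreg 1).2.1 x).1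
    | succ n ih =>
      rw [hu n, hu (n + 1)]
      exact relax_mono hρa.le (hint _) (hint _) ih
  let lam : M → ℝ := fun x ↦ ⨆ n, u n x
  have hlim : ∀ x, Tendsto (fun n ↦ u n x) atTop (𝓝 (lam x)) := fun x ↦
    tendsto_atTop_ciSup (fun m n hmn ↦ hmono hmn x)
      ⟨1, by rintro _ ⟨n, rfl⟩; exact ((hreg n).2.1 x).2⟩
  refine ⟨lam, ⟨?_, ?_, ?_, ?_⟩, ?_⟩
  · exact measurable_of_tendsto_metrizable (fun n ↦ (hreg n).1) (tendsto_pi_nhds.2 hlim)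
  · exact fun x ↦ isClosed_Icc.mem_of_tendsto (hlim x) (Eventually.of_forall fun n ↦ (hreg n).2.1 x)
  · intro x hx
    refine tendsto_nhds_unique ((hlim x).comp (tendsto_add_atTop_nat 1)) ?_
    refine tendsto_const_nhds.congr fun n ↦ ?_
    simp [hu, relax_of_mem hx]
  · intro x hx
    have h1 : Tendsto (fun n ↦ ∫ y in closedBall x r, u n y ∂μ) atTop
        (𝓝 (∫ y in closedBall x r, lam y ∂μ)) := by
      refine tendsto_integral_of_dominated_convergence (fun _ ↦ 1)
        (fun n ↦ (hreg n).1.aestronglyMeasurable) (integrable_const _) ?_ (ae_of_all _ hlim)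
      intro n
      refine ae_of_all _ fun y ↦ ?_
      rw [Real.norm_of_nonneg ((hreg n).2.1 y).1]
      exact ((hreg n).2.1 y).2
    have h2 : Tendsto (fun n ↦ (ρ + a) * u (n + 1) x) atTop (𝓝 ((ρ + a) * lam x)) :=
      ((hlim x).comp (tendsto_add_atTop_nat 1)).const_mul _
    refine tendsto_nhds_unique h2 (h1.congr fun n ↦ ?_)
    rw [hu, relax_of_notMem hx, mul_div_cancel₀ _ hρa.ne']
  · exact fun x x' hxx ↦ le_of_tendsto_of_tendsto' (hlim x') (hlim x) fun n ↦ (hreg n).2.2 x x' hxx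

end Averaging

theorem isVoltage_iff_isBallVoltage {d : ℕ} {c : NNReal} {xs : UnitSphere d} {r rs ρ a : ℝ}
    (hρa : ρ + a ≠ 0) {lam : UnitSphere d → ℝ} :
    IsVoltage d c xs r rs ρ a lam ↔
      IsBallVoltage (uniformMeasure d c) r ρ a (closedBall xs rs) lam := by
  have key : Measurable lam → (∀ x, lam x ∈ Icc (0 : ℝ) 1) → (∀ x ∈ closedBall xs rs, lam x = 1) →
      ∀ x, (∫ y in closedBall xs rs, radialKernel r x y ∂(uniformMeasure d c)) +
        ∫ y in (closedBall xs rs)ᶜ, radialKernel r x y * lam y ∂(uniformMeasure d c) =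
          ∫ y in closedBall x r, lam y ∂uniformMeasure d c := by
    intro hm hI h1 x
    have hk : ∀ y, radialKernel r x y * lam y = (closedBall x r).indicator lam y := by
      intro y
      by_cases hy : y ∈ closedBall x r
      · rw [indicator_of_mem hy, radialKernel, indicator_of_mem (by simpa using mem_closedBall'.1 hy)]
        simp
      · rw [indicator_of_notMem hy, radialKernel,
          indicator_of_notMem (by simpa [dist_comm] using hy), zero_mul]
    have hms : MeasurableSet (closedBall xs rs) := isClosed_closedBall.measurableSet
    have hmx : MeasurableSet (closedBall x r) := isClosed_closedBall.measurableSet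
    rw [← integral_indicator hmx, ← integral_add_compl hms
      ((integrable_of_mem_Icc hm hI).indicator hmx)]
    congr 1
    · refine setIntegral_congr_fun hms fun y hy ↦ ?_
      change radialKernel r x y = (closedBall x r).indicator lam y
      rw [← hk, h1 y hy, mul_one]
    · exact setIntegral_congr_fun hms.compl fun y _ ↦ hk y
  constructor
  · intro h
    refine ⟨h.measurable, h.mem_Icc, h.eq_one, fun x hx ↦ ?_⟩
    rw [h.eq_average x hx, key h.measurable h.mem_Icc h.eq_one, mul_div_cancel₀ _ hρa]
  · intro h
    refine ⟨h.measurable, h.mem_Icc, h.eq_one, fun x hx ↦ ?_⟩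
    rw [key h.measurable h.mem_Icc h.eq_one, ← h.eq_integral x hx, mul_div_cancel_left₀ _ hρa]

/-! ### Two-point symmetrisation -/

section Symmetrisation

variable {d : ℕ}

/-- The reflection of the sphere exchanging `x` and `x'`. -/
def swapMap (x x' : UnitSphere d) : UnitSphere d → UnitSphere d :=
  sphereMap (ℝ ∙ ((x : EuclideanSpace ℝ (Fin d)) - x'))ᗮ.reflection

theorem swapMap_left (x x' : UnitSphere d) : swapMap x x' x = x' :=
  Subtype.ext <| Submodule.reflection_sub (by rw [norm_eq_of_mem_sphere, norm_eq_of_mem_sphere])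

theorem swapMap_swapMap (x x' y : UnitSphere d) : swapMap x x' (swapMap x x' y) = y :=
  Subtype.ext <| Submodule.reflection_reflection _ _

/-- For `x = x'` the reflection is the identity, and the quotient on the right is `0 / 0 = 0`. -/
theorem inner_swapMap (x x' y z : UnitSphere d) :
    ⟪(z : EuclideanSpace ℝ (Fin d)), swapMap x x' y⟫ =
      ⟪(z : EuclideanSpace ℝ (Fin d)), y⟫ -
        2 * (⟪(x : EuclideanSpace ℝ (Fin d)) - x', y⟫ / ‖(x : EuclideanSpace ℝ (Fin d)) - x'‖ ^ 2) *
          ⟪(z : EuclideanSpace ℝ (Fin d)), x - x'⟫ := by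
  change ⟪(z : EuclideanSpace ℝ (Fin d)), (ℝ ∙ ((x : EuclideanSpace ℝ (Fin d)) - x'))ᗮ.reflection
    (y : EuclideanSpace ℝ (Fin d))⟫ = _
  rw [Submodule.reflection_orthogonal_apply, Submodule.reflection_singleton_apply, neg_sub,
    inner_sub_right, two_smul, inner_add_right, real_inner_smul_right]
  simp only [RCLike.ofReal_real_eq_id, id_eq]
  ring

theorem mem_closedBall_swapMap (x x' y : UnitSphere d) (r : ℝ) :
    swapMap x x' y ∈ closedBall x' r ↔ y ∈ closedBall x r := by
  rw [mem_closedBall, mem_closedBall]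
  have h : dist (swapMap x x' y) (swapMap x x' x) = dist y x := dist_sphereMap _ _ _
  rw [swapMap_left] at h
  rw [h]

/-- The ball integral of a radially decreasing function is radially decreasing: with `σ` the
reflection exchanging the two centres, the difference of the two ball integrals is half the integral
of `(𝟙_{B(x)} - 𝟙_{B(x')}) * (f - f ∘ σ)`, whose two factors have the same sign everywhere. -/
theorem setIntegral_closedBall_le_of_geoDist_le (c : NNReal) {r : ℝ} {xs : UnitSphere d}
    {f : UnitSphere d → ℝ} (hm : Measurable f) (hI : ∀ x, f x ∈ Icc (0 : ℝ) 1)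
    (hf : ∀ x x', geoDist xs x ≤ geoDist xs x' → f x' ≤ f x) {x x' : UnitSphere d}
    (hx : geoDist xs x ≤ geoDist xs x') :
    ∫ y in closedBall x' r, f y ∂uniformMeasure d c ≤
      ∫ y in closedBall x r, f y ∂uniformMeasure d c := by
  classical
  set σ := swapMap x x'
  set F : UnitSphere d → ℝ := fun y ↦
    (closedBall x r).indicator f y - (closedBall x' r).indicator f y with hF
  have hms : ∀ x : UnitSphere d, MeasurableSet (closedBall x r) :=
    fun x ↦ isClosed_closedBall.measurableSet
  have hfi : Integrable f (uniformMeasure d c) := integrable_of_mem_Icc hm hI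
  have hFi : Integrable F (uniformMeasure d c) := (hfi.indicator (hms x)).sub (hfi.indicator (hms x'))
  have hint : ∫ y, F y ∂uniformMeasure d c = (∫ y in closedBall x r, f y ∂uniformMeasure d c) -
      ∫ y in closedBall x' r, f y ∂uniformMeasure d c := by
    rw [integral_sub (hfi.indicator (hms x)) (hfi.indicator (hms x')), integral_indicator (hms x),
      integral_indicator (hms x')]
  have hmp := measurePreserving_sphereMap c
    (ℝ ∙ ((x : EuclideanSpace ℝ (Fin d)) - x'))ᗮ.reflection
  have hσ : ∫ y, F (σ y) ∂uniformMeasure d c = ∫ y, F y ∂uniformMeasure d c :=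
    hmp.integral_comp (measurableEmbedding_sphereMap _) F
  have hpos : ∀ y, 0 ≤ F y + F (σ y) := by
    intro y
    have h1 : σ y ∈ closedBall x' r ↔ y ∈ closedBall x r := mem_closedBall_swapMap x x' y r
    have h2 : σ y ∈ closedBall x r ↔ y ∈ closedBall x' r := by
      rw [← mem_closedBall_swapMap x x' (σ y) r, swapMap_swapMap]
    have hxs : 0 ≤ ⟪(xs : EuclideanSpace ℝ (Fin d)), x - x'⟫ := by
      rw [inner_sub_right, sub_nonneg]; exact geoDist_le_geoDist_iff.1 hx
    have hσin := inner_swapMap x x' y xs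
    have hd1 := dist_sq_eq x y
    have hd2 := dist_sq_eq x' y
    have hv : ⟪(x : EuclideanSpace ℝ (Fin d)) - x', y⟫ =
      ⟪(x : EuclideanSpace ℝ (Fin d)), y⟫ - ⟪(x' : EuclideanSpace ℝ (Fin d)), y⟫ :=
        inner_sub_left _ _ _
    rcases le_total 0 ⟪(x : EuclideanSpace ℝ (Fin d)) - x', y⟫ with hs | hs
    · have hk : y ∈ closedBall x' r → y ∈ closedBall x r := by
        rw [mem_closedBall', mem_closedBall']
        exact (le_trans · ) (abs_le_of_sq_le_sq' (by linarith) dist_nonneg).2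
      have hfy : f (σ y) ≤ f y := by
        refine hf _ _ (geoDist_le_geoDist_iff.2 ?_)
        rw [hσin, sub_le_self_iff]
        positivity
      by_cases hy : y ∈ closedBall x r <;> by_cases hy' : y ∈ closedBall x' r <;>
        first
        | exact absurd (hk hy') hy
        | simp only [hF, indicator_apply, h1, h2, hy, hy', ↓reduceIte]; linarith
    · have hk : y ∈ closedBall x r → y ∈ closedBall x' r := by
        rw [mem_closedBall', mem_closedBall']
        exact (le_trans · ) (abs_le_of_sq_le_sq' (by linarith) dist_nonneg).2
      have hfy : f y ≤ f (σ y) := by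
        refine hf _ _ (geoDist_le_geoDist_iff.2 ?_)
        rw [hσin, le_sub_self_iff]
        refine mul_nonpos_of_nonpos_of_nonneg ?_ hxs
        have := div_nonpos_of_nonpos_of_nonneg hs
          (sq_nonneg ‖(x : EuclideanSpace ℝ (Fin d)) - x'‖)
        linarith
      by_cases hy : y ∈ closedBall x r <;> by_cases hy' : y ∈ closedBall x' r <;>
        first
        | exact absurd (hk hy) hy'
        | simp only [hF, indicator_apply, h1, h2, hy, hy', ↓reduceIte]; linarith
  have h0 : 0 ≤ ∫ y, (F y + F (σ y)) ∂uniformMeasure d c := integral_nonneg hpos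
  have hFσ : Integrable (fun y ↦ F (σ y)) (uniformMeasure d c) :=
    hmp.integrable_comp_of_integrable hFi
  rw [integral_add hFi hFσ, hσ, hint] at h0
  linarith

/-- The voltage of a geodesic ball exists and is radially decreasing about its centre. -/
theorem exists_isBallVoltage_radial (c : NNReal) {r rs ρ a : ℝ} (hrs : 0 ≤ rs)
    (hvol : ∀ x : UnitSphere d, (uniformMeasure d c).real (closedBall x r) = a) (ha : 0 ≤ a)
    (hρ : 0 < ρ) (xs : UnitSphere d) :
    ∃ lam, IsBallVoltage (uniformMeasure d c) r ρ a (closedBall xs rs) lam ∧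
      ∀ x x', geoDist xs x ≤ geoDist xs x' → lam x' ≤ lam x := by
  refine exists_isBallVoltage isClosed_closedBall.measurableSet hvol ha hρ _ ?_
  intro f hm hI hf x x' hx
  by_cases h : x ∈ closedBall xs rs
  · rw [relax_of_mem h]
    exact (relax_mem_Icc hvol ha hρ hm hI x').2
  · have h' : x' ∉ closedBall xs rs := fun h' ↦ h <|
      (mem_closedBall_iff_geoDist_le hrs _ _).2
        (hx.trans ((mem_closedBall_iff_geoDist_le hrs _ _).1 h'))
    rw [relax_of_notMem h, relax_of_notMem h']
    exact div_le_div_of_nonneg_right (setIntegral_closedBall_le_of_geoDist_le c hm hI hf hx)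
      (by linarith)

end Symmetrisation

/-! ### The supersolution near the antipode -/

section Supersolution

open Real

/-- A spherical counterpart of `√(m ^ 2 + 1) ≤ m + 1 / 2` for `m ≥ 3 / 4`. -/
theorem cos_add_half_le {φ ψ : ℝ} (hφ : 0 < φ) (hφ2 : φ < π / 2) (h1 : 3 / 4 * φ ≤ ψ)
    (h2 : ψ ≤ π / 2) : cos (ψ + φ / 2) ≤ cos φ * cos ψ := by
  have e1 : cos φ - cos (φ / 2) = -2 * sin (3 * (φ / 4)) * sin (φ / 4) := by
    rw [cos_sub_cos, show (φ + φ / 2) / 2 = 3 * (φ / 4) by ring,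
      show (φ - φ / 2) / 2 = φ / 4 by ring]
  have e2 : sin (φ / 2) = 2 * sin (φ / 4) * cos (φ / 4) := by
    rw [← sin_two_mul]; congr 1; ring
  have s1 : 0 ≤ sin (φ / 4) := sin_nonneg_of_nonneg_of_le_pi (by linarith) (by linarith)
  have s3 : 0 ≤ sin (3 * (φ / 4)) := sin_nonneg_of_nonneg_of_le_pi (by linarith) (by linarith)
  have s4 : sin (3 * (φ / 4)) ≤ sin ψ := sin_le_sin_of_le_of_le_pi_div_two (by linarith) h2
    (by linarith)
  have c1 : cos ψ ≤ cos (φ / 4) := cos_le_cos_of_nonneg_of_le_pi (by linarith) (by linarith)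
    (by linarith)
  have c0 : 0 ≤ cos ψ := cos_nonneg_of_neg_pi_div_two_le_of_le (by linarith) h2
  have key : cos ψ * sin (3 * (φ / 4)) ≤ cos (φ / 4) * sin ψ :=
    mul_le_mul c1 s4 s3 (c0.trans c1)
  have h : 0 ≤ 2 * sin (φ / 4) * (cos (φ / 4) * sin ψ - cos ψ * sin (3 * (φ / 4))) :=
    mul_nonneg (by linarith) (by linarith)
  rw [cos_add, e2]
  have e3 : cos φ = cos (φ / 2) + -2 * sin (3 * (φ / 4)) * sin (φ / 4) := by linarith
  rw [e3]
  linarith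

/-- If two points of the sphere are opposite with respect to a third one, at distance at most `φ`
from it, then the mean of their distances `α`, `β` to a pole exceeds the distance `ψ` of the third
point by at most `φ / 2`, provided `ψ` is not much smaller than `φ`. -/
theorem half_add_le_max {φ ψ ω α β : ℝ} (hφ : 0 < φ) (hφ2 : φ < π / 2) (hα : α ∈ Icc 0 π)
    (hβ : β ∈ Icc 0 π) (hψ : ψ ∈ Icc 0 π) (hω : ω ∈ Icc 0 φ) (hαψ : |α - ψ| ≤ ω)
    (hβψ : |β - ψ| ≤ ω) (hcos : cos α + cos β = 2 * cos ω * cos ψ) :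
    (α + β) / 2 ≤ max ψ (3 / 4 * φ) + φ / 2 := by
  obtain ⟨hα0, hα1⟩ := hα
  obtain ⟨hβ0, hβ1⟩ := hβ
  obtain ⟨hψ0, hψ1⟩ := hψ
  obtain ⟨hω0, hω1⟩ := hω
  rw [abs_le] at hαψ hβψ
  have hδ : |(α - β) / 2| ≤ ω := abs_le.2 ⟨by linarith, by linarith⟩
  have hωδ : cos ω ≤ cos ((α - β) / 2) := by
    rw [← cos_abs ((α - β) / 2)]
    exact cos_le_cos_of_nonneg_of_le_pi (abs_nonneg _) (by linarith) hδ
  have hω' : 0 < cos ω := cos_pos_of_mem_Ioo ⟨by linarith, by linarith⟩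
  have hm : cos ((α + β) / 2) * cos ((α - β) / 2) = cos ω * cos ψ := by
    rw [cos_add_cos] at hcos; linarith
  have hle : ∀ u, 0 ≤ u → u ≤ π → cos u ≤ cos ((α + β) / 2) → (α + β) / 2 ≤ u := by
    intro u h0 h1 h
    exact (strictAntiOn_cos.le_iff_ge ⟨h0, h1⟩ ⟨by linarith, by linarith⟩).1 h
  have hδ1 := cos_le_one ((α - β) / 2)
  have hδ0 : 0 < cos ((α - β) / 2) := hω'.trans_le hωδ
  rcases le_total (π / 2) ψ with h | h
  · have hc : cos ψ ≤ 0 := cos_nonpos_of_pi_div_two_le_of_le h (by linarith)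
    have : (α + β) / 2 ≤ ψ := by
      refine hle ψ hψ0 hψ1 ?_
      have : cos ψ * cos ((α - β) / 2) ≤ cos ((α + β) / 2) * cos ((α - β) / 2) := by
        rw [hm]; nlinarith
      exact le_of_mul_le_mul_right this hδ0
    linarith [le_max_left ψ (3 / 4 * φ)]
  · have hc : 0 ≤ cos ψ := cos_nonneg_of_neg_pi_div_two_le_of_le (by linarith) h
    have hM : max ψ (3 / 4 * φ) ≤ π / 2 := max_le h (by linarith)
    have hM0 : 0 ≤ max ψ (3 / 4 * φ) := hψ0.trans (le_max_left _ _)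
    refine hle _ (by linarith) (by linarith) ?_
    have h1 : cos (max ψ (3 / 4 * φ)) ≤ cos ψ :=
      cos_le_cos_of_nonneg_of_le_pi hψ0 (by linarith) (le_max_left _ _)
    have h2 : cos φ ≤ cos ω := cos_le_cos_of_nonneg_of_le_pi hω0 (by linarith) hω1
    have h3 : 0 ≤ cos (max ψ (3 / 4 * φ)) :=
      cos_nonneg_of_neg_pi_div_two_le_of_le (by linarith) hM
    have h4 : 0 ≤ cos ((α + β) / 2) :=
      nonneg_of_mul_nonneg_left (hm ▸ mul_nonneg hω'.le hc) hδ0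
    calc cos (max ψ (3 / 4 * φ) + φ / 2) ≤ cos φ * cos (max ψ (3 / 4 * φ)) :=
          cos_add_half_le hφ hφ2 (le_max_right _ _) hM
      _ ≤ cos ω * cos ψ := mul_le_mul h2 h1 h3 hω'.le
      _ ≤ cos ((α + β) / 2) := by rw [← hm]; exact mul_le_of_le_one_right h4 hδ1

/-- The number of steps of length `φ` charged to a point at distance `u` from the antipode of the
source. The threshold `3 / 4` is where `cos_add_half_le` begins to hold. -/
def stepCount (φ u : ℝ) : ℝ := max (u / φ - 3 / 4) 0

theorem stepCount_nonneg (φ u : ℝ) : 0 ≤ stepCount φ u := le_max_right _ _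

theorem stepCount_eq {φ : ℝ} (hφ : 0 < φ) (u : ℝ) :
    stepCount φ u = max u (3 / 4 * φ) / φ - 3 / 4 := by
  have h : max u (3 / 4 * φ) / φ = max (u / φ) (3 / 4) := by
    rw [← max_div_div_right hφ.le, mul_div_cancel_right₀ _ hφ.ne']
  rw [h, stepCount, ← max_sub_sub_right, sub_self]

theorem stepCount_mono {φ : ℝ} (hφ : 0 < φ) : Monotone (stepCount φ) := by
  intro u v h
  unfold stepCount
  gcongr

/-- Two-point case of Karamata's inequality for the exponential: the pair `(A, B)` is weakly
majorised by `(C + 1, C)`. -/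
theorem exp_add_exp_le {L A B C : ℝ} (hL : 0 ≤ L) (hA : A ≤ C + 1) (hB : B ≤ C + 1)
    (hAB : A + B ≤ 2 * C + 1) : exp (L * A) + exp (L * B) ≤ (exp L + 1) * exp (L * C) := by
  have e : ∀ A, exp (L * A) = exp (L * (A - C)) * exp (L * C) := by
    intro A; rw [← exp_add]; congr 1; ring
  rw [e A, e B, ← add_mul]
  refine mul_le_mul_of_nonneg_right ?_ (exp_pos _).le
  have hX : exp (L * (A - C)) ≤ exp L := exp_le_exp.2 (by nlinarith)
  have hY : exp (L * (B - C)) ≤ exp L := exp_le_exp.2 (by nlinarith)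
  have hXY : exp (L * (A - C)) * exp (L * (B - C)) ≤ exp L := by
    rw [← exp_add]; exact exp_le_exp.2 (by nlinarith)
  have hX0 := exp_pos (L * (A - C))
  rcases le_total 1 (exp (L * (A - C))) with h | h
  · -- with `X ≥ 1`, multiply by `X` and use `(X - 1) * (exp L - X) ≥ 0`
    refine le_of_mul_le_mul_left ?_ hX0
    nlinarith [mul_nonneg (sub_nonneg.2 h) (sub_nonneg.2 hX)]
  · linarith

/-- The supersolution inequality for a pair of points opposite with respect to a third one. -/
theorem exp_stepCount_add_le {φ ψ ω α β L : ℝ} (hL : 0 ≤ L) (hφ : 0 < φ) (hφ2 : φ < π / 2)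
    (hα : α ∈ Icc 0 π) (hβ : β ∈ Icc 0 π) (hψ : ψ ∈ Icc 0 π) (hω : ω ∈ Icc 0 φ)
    (hαψ : |α - ψ| ≤ ω) (hβψ : |β - ψ| ≤ ω) (hcos : cos α + cos β = 2 * cos ω * cos ψ) :
    exp (L * stepCount φ α) + exp (L * stepCount φ β) ≤
      (exp L + 1) * exp (L * stepCount φ ψ) := by
  have hmax := half_add_le_max hφ hφ2 hα hβ hψ hω hαψ hβψ hcos
  have hψN := stepCount_nonneg φ ψ
  have step : ∀ u, |u - ψ| ≤ ω → stepCount φ u ≤ stepCount φ ψ + 1 := by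
    intro u hu
    have hu' : u ≤ ψ + φ := by linarith [(abs_le.1 hu).2, hω.2]
    refine max_le ?_ (by linarith)
    have : u / φ ≤ ψ / φ + 1 := by
      rw [div_add_one hφ.ne']; gcongr
    linarith [le_max_left (ψ / φ - 3 / 4) 0, show stepCount φ ψ = max (ψ / φ - 3 / 4) 0 from rfl]
  have hA := step α hαψ
  have hB := step β hβψ
  refine exp_add_exp_le hL hA hB ?_
  rcases le_total (α / φ - 3 / 4) 0 with h | h
  · have : stepCount φ α = 0 := max_eq_right h
    linarith
  rcases le_total (β / φ - 3 / 4) 0 with h' | h'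
  · have : stepCount φ β = 0 := max_eq_right h'
    linarith
  have h1 : stepCount φ α = α / φ - 3 / 4 := max_eq_left h
  have h2 : stepCount φ β = β / φ - 3 / 4 := max_eq_left h'
  rw [h1, h2, stepCount_eq hφ ψ]
  have : (α + β) / φ ≤ (2 * max ψ (3 / 4 * φ) + φ) / φ :=
    div_le_div_of_nonneg_right (by linarith) hφ.le
  rw [add_div, add_div, div_self hφ.ne', mul_div_assoc] at this
  linarith

variable {d : ℕ}

/-- The reflection of the sphere in the axis through `x`. -/
def axisMap (x : UnitSphere d) : UnitSphere d → UnitSphere d :=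
  sphereMap (ℝ ∙ (x : EuclideanSpace ℝ (Fin d))).reflection

theorem axisMap_self (x : UnitSphere d) : axisMap x x = x :=
  Subtype.ext <| Submodule.reflection_mem_subspace_eq_self (Submodule.mem_span_singleton_self _)

theorem inner_axisMap (x y z : UnitSphere d) :
    ⟪(z : EuclideanSpace ℝ (Fin d)), axisMap x y⟫ =
      2 * ⟪(x : EuclideanSpace ℝ (Fin d)), y⟫ * ⟪(z : EuclideanSpace ℝ (Fin d)), x⟫ -
        ⟪(z : EuclideanSpace ℝ (Fin d)), y⟫ := by
  change ⟪(z : EuclideanSpace ℝ (Fin d)), (ℝ ∙ (x : EuclideanSpace ℝ (Fin d))).reflection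
    (y : EuclideanSpace ℝ (Fin d))⟫ = _
  rw [Submodule.reflection_singleton_apply, inner_sub_right, two_smul, inner_add_right,
    real_inner_smul_right, norm_eq_of_mem_sphere]
  simp only [RCLike.ofReal_real_eq_id, id_eq]
  ring

theorem geoDist_axisMap (x y : UnitSphere d) : geoDist x (axisMap x y) = geoDist x y := by
  have := geoDist_sphereMap (ℝ ∙ (x : EuclideanSpace ℝ (Fin d))).reflection x y
  conv_lhs at this => rw [show sphereMap _ x = x from axisMap_self x]
  exact this

theorem abs_geoDist_sub_le (xs x y : UnitSphere d) :
    |geoDist xs y - geoDist xs x| ≤ geoDist x y := by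
  rw [abs_le]
  have h1 := geoDist_triangle xs x y
  have h2 := geoDist_triangle xs y x
  rw [geoDist_comm y x] at h2
  constructor <;> linarith

/-- The exponential of the step count is a supersolution on the whole sphere: the points of the
ball about `x` are paired by the reflection in the axis through `x`. -/
theorem setIntegral_exp_stepCount_le (c : NNReal) {r a L : ℝ} (hr : 0 < r)
    (hφ2 : arcLength r < π / 2)
    (hvol : ∀ x : UnitSphere d, (uniformMeasure d c).real (closedBall x r) = a) (hL : 0 ≤ L)
    (xs x : UnitSphere d) :
    ∫ y in closedBall x r, exp (L * stepCount (arcLength r) (π - geoDist xs y))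
        ∂uniformMeasure d c ≤
      a * ((exp L + 1) / 2) * exp (L * stepCount (arcLength r) (π - geoDist xs x)) := by
  set F : UnitSphere d → ℝ := fun y ↦ exp (L * stepCount (arcLength r) (π - geoDist xs y)) with hF
  have hcont : Continuous F := by
    have := continuous_geoDist xs
    unfold stepCount at hF
    rw [hF]
    fun_prop
  have hint : ∀ f : UnitSphere d → ℝ, Continuous f → Integrable f (uniformMeasure d c) :=
    fun f hf ↦ hf.integrable_of_hasCompactSupport (HasCompactSupport.of_compactSpace _)
  have hcont' : Continuous fun y ↦ F (axisMap x y) := hcont.comp (continuous_sphereMap _)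
  have hsym : ∫ y in closedBall x r, F (axisMap x y) ∂uniformMeasure d c =
      ∫ y in closedBall x r, F y ∂uniformMeasure d c := by
    have := setIntegral_comp_sphereMap c (ℝ ∙ (x : EuclideanSpace ℝ (Fin d))).reflection F x r
    rwa [show sphereMap (ℝ ∙ (x : EuclideanSpace ℝ (Fin d))).reflection x = x from
      axisMap_self x] at this
  have hpt : ∀ y ∈ closedBall x r, F y + F (axisMap x y) ≤ (exp L + 1) * F x := by
    intro y hy
    have hy' := (mem_closedBall_iff_geoDist_le hr.le x y).1 hy
    have hIcc : ∀ z : UnitSphere d, π - geoDist xs z ∈ Icc 0 π := fun z ↦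
      ⟨by linarith [geoDist_le_pi xs z], by linarith [geoDist_nonneg xs z]⟩
    have habs : ∀ z : UnitSphere d, |π - geoDist xs z - (π - geoDist xs x)| ≤ geoDist x z := by
      intro z
      rw [sub_sub_sub_cancel_left, abs_sub_comm]
      exact abs_geoDist_sub_le xs x z
    refine exp_stepCount_add_le hL (arcLength_pos hr) hφ2 (hIcc _) (hIcc _) (hIcc _)
      ⟨geoDist_nonneg x y, hy'⟩ (habs y) ((habs _).trans_eq (geoDist_axisMap x y)) ?_
    rw [cos_pi_sub, cos_pi_sub, cos_pi_sub, cos_geoDist, cos_geoDist, cos_geoDist, cos_geoDist,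
      inner_axisMap]
    ring
  have h1 : ∫ y in closedBall x r, (F y + F (axisMap x y)) ∂uniformMeasure d c ≤
      ∫ _ in closedBall x r, (exp L + 1) * F x ∂uniformMeasure d c :=
    setIntegral_mono_on (hint _ (hcont.add hcont')).integrableOn (integrable_const _).integrableOn
      isClosed_closedBall.measurableSet hpt
  rw [integral_add (hint _ hcont).integrableOn (hint _ hcont').integrableOn, hsym,
    setIntegral_const, hvol, smul_eq_mul] at h1
  change ∫ y in closedBall x r, F y ∂uniformMeasure d c ≤ a * ((exp L + 1) / 2) * F x
  linarith

/-- Decay of the voltage in terms of the step count. -/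
theorem IsBallVoltage.le_exp_stepCount {c : NNReal} {r rs ρ a : ℝ} {xs : UnitSphere d}
    {lam : UnitSphere d → ℝ}
    (h : IsBallVoltage (uniformMeasure d c) r ρ a (closedBall xs rs) lam) (hr : 0 < r)
    (hrs : 0 ≤ rs) (hφ2 : arcLength r < π / 2)
    (hvol : ∀ x : UnitSphere d, (uniformMeasure d c).real (closedBall x r) = a) (ha : 0 < a)
    (hρ : 0 < ρ) (x : UnitSphere d) :
    lam x ≤ exp (-(stepCount (arcLength r) (π - arcLength rs) -
      stepCount (arcLength r) (π - geoDist xs x)) * log (1 + 2 * ρ / a)) := by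
  set L := log (1 + 2 * ρ / a) with hLdef
  have hρa : 0 < 2 * ρ / a := by positivity
  have hL : 0 ≤ L := log_nonneg (by linarith)
  have hexp : exp L = 1 + 2 * ρ / a := exp_log (by linarith)
  set N₀ := stepCount (arcLength r) (π - arcLength rs)
  have hform : ∀ y, exp (-(N₀ - stepCount (arcLength r) (π - geoDist xs y)) * L) =
      exp (-(N₀ * L)) * exp (L * stepCount (arcLength r) (π - geoDist xs y)) := by
    intro y; rw [← exp_add]; congr 1; ring
  refine h.le_of_supersolution
    (G := fun y ↦ exp (-(N₀ - stepCount (arcLength r) (π - geoDist xs y)) * L))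
    hvol ha.le hρ ?_ (fun y ↦ (exp_pos _).le) ?_ ?_ x
  · refine Continuous.integrable_of_hasCompactSupport ?_ (HasCompactSupport.of_compactSpace _)
    have := continuous_geoDist xs
    unfold stepCount
    fun_prop
  · intro y hy
    rw [mem_closedBall_iff_geoDist_le hrs] at hy
    have : N₀ ≤ stepCount (arcLength r) (π - geoDist xs y) :=
      stepCount_mono (arcLength_pos hr) (by linarith)
    exact one_le_exp (mul_nonneg (by linarith) hL)
  · intro y _
    simp only [hform]
    rw [integral_const_mul]
    have := mul_le_mul_of_nonneg_left (setIntegral_exp_stepCount_le c hr hφ2 hvol hL xs y)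
      (exp_pos (-(N₀ * L))).le
    refine this.trans_eq ?_
    rw [hexp]
    field_simp
    ring

/-- The step count drops by at least `t` between the rim of the source and the points at distance
`z + t * φ(r)`. Both alternatives in `hcase` give `φ(rs) + 3 / 4 * φ(r) ≤ z`, which absorbs the
truncation in the definition of the step count. -/
theorem le_stepCount_sub {r rs z t : ℝ} (hr : 0 < r)
    (hφr : arcLength r ≤ 8 / 7 * r) (hrs : 0 < rs) (hz : 2 * r ≤ z)
    (hcase : rs ≤ r ∨ arcLength rs + arcLength r ≤ z)
    (hzt : z + t * arcLength r ≤ π) :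
    t ≤ stepCount (arcLength r) (π - arcLength rs) -
      stepCount (arcLength r) (π - (z + t * arcLength r)) := by
  have hφ := arcLength_pos hr
  have h74 : arcLength rs + 3 / 4 * arcLength r ≤ z := by
    rcases hcase with h | h
    · have : arcLength rs ≤ arcLength r := by
        unfold arcLength
        exact arccos_le_arccos (by nlinarith)
      linarith
    · linarith
  have h0 : (π - arcLength rs) / arcLength r - 3 / 4 ≤
      stepCount (arcLength r) (π - arcLength rs) := le_max_left _ _
  have h1 : t * arcLength r / arcLength r = t := mul_div_cancel_right₀ _ hφ.ne'
  suffices stepCount (arcLength r) (π - (z + t * arcLength r)) ≤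
      (π - arcLength rs) / arcLength r - 3 / 4 - t by linarith
  refine max_le ?_ ?_
  · have : (π - (z + t * arcLength r)) / arcLength r ≤
        (π - arcLength rs - t * arcLength r) / arcLength r := by gcongr ?_ / _; linarith
    rw [sub_div _ (t * arcLength r), h1] at this
    linarith
  · have : (t * arcLength r + 3 / 4 * arcLength r) / arcLength r ≤
        (π - arcLength rs) / arcLength r := by gcongr; linarith
    rw [add_div, h1, mul_div_cancel_right₀ _ hφ.ne'] at this
    linarith

theorem two_mul_sin_half_arcLength {r : ℝ} (hr : 0 ≤ r) (hr2 : r ≤ 2) :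
    2 * sin (arcLength r / 2) = r := by
  have h := cos_arccos (x := 1 - r ^ 2 / 2) (by nlinarith) (by nlinarith)
  change cos (arcLength r) = _ at h
  have h2 := cos_two_mul (arcLength r / 2)
  rw [mul_div_cancel₀ _ two_ne_zero] at h2
  have h3 := sin_sq_add_cos_sq (arcLength r / 2)
  have h0 : 0 ≤ sin (arcLength r / 2) := by
    have h4 : 0 ≤ arcLength r := arccos_nonneg _
    have h5 : arcLength r ≤ π := arccos_le_pi _
    exact sin_nonneg_of_nonneg_of_le_pi (by linarith) (by linarith)
  refine (sq_eq_sq₀ (by linarith) hr).1 ?_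
  nlinarith

/-- The bounds on `φ(r)` available as soon as `2 * r + φ(r) ≤ π`. -/
theorem arcLength_bounds {r : ℝ} (hr : 0 < r) (hr2 : r ≤ 2) (h : 2 * r + arcLength r ≤ π) :
    arcLength r < π / 2 ∧ arcLength r ≤ 8 / 7 * r := by
  have hφ := arcLength_pos hr
  have hs := two_mul_sin_half_arcLength hr.le hr2
  have hle : r ≤ arcLength r := by
    have := sin_le (x := arcLength r / 2) (by linarith)
    linarith
  have hπ := pi_lt_d2
  have hπ3 := pi_gt_d2
  have hφ2 : arcLength r < π / 2 := by
    unfold arcLength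
    rw [arccos_lt_pi_div_two]
    nlinarith
  refine ⟨hφ2, ?_⟩
  have hc := sin_gt_sub_cube (x := arcLength r / 2) (by linarith)
  have hsq : arcLength r ^ 2 ≤ 3 := by nlinarith
  nlinarith

end Supersolution

/-! ### The lower bound -/

section LowerBound

variable {d : ℕ}

/-- The gap between `φ(r)` and `2 * φ(r / 2)` is what gives a lower bound uniform in `ρ`. -/
theorem two_mul_arcLength_half_lt {r : ℝ} (hr : 0 < r) (hr2 : r ≤ 2) :
    2 * arcLength (r / 2) < arcLength r := by
  have hle : arcLength (r / 2) ≤ Real.pi / 2 := by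
    unfold arcLength
    rw [Real.arccos_le_pi_div_two]
    nlinarith
  have h0 : 0 < arcLength (r / 2) := arcLength_pos (by linarith)
  have hc : Real.cos (arcLength (r / 2)) = 1 - (r / 2) ^ 2 / 2 :=
    Real.cos_arccos (by nlinarith) (by nlinarith)
  have hc' : Real.cos (arcLength r) = 1 - r ^ 2 / 2 :=
    Real.cos_arccos (by nlinarith) (by nlinarith)
  refine (Real.strictAntiOn_cos.lt_iff_gt ⟨(arcLength_pos hr).le, Real.arccos_le_pi _⟩
    ⟨by linarith, by linarith⟩).1 ?_
  rw [Real.cos_two_mul, hc, hc']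
  nlinarith [pow_pos hr 4]

theorem exists_arcLength_eq {ε : ℝ} (h0 : 0 < ε) (h1 : ε ≤ Real.pi) :
    ∃ R, 0 < R ∧ arcLength R = ε := by
  refine ⟨2 * Real.sin (ε / 2), mul_pos two_pos
    (Real.sin_pos_of_pos_of_lt_pi (by linarith) (by linarith)), ?_⟩
  unfold arcLength
  rw [show 1 - (2 * Real.sin (ε / 2)) ^ 2 / 2 = Real.cos ε by
    have h := Real.cos_two_mul (ε / 2)
    rw [mul_div_cancel₀ _ two_ne_zero] at h
    have := Real.sin_sq_add_cos_sq (ε / 2)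
    linarith]
  exact Real.arccos_cos h0.le h1

theorem measure_closedBall_pos {c : NNReal} (hc : 0 < c) {R : ℝ} (hR : 0 < R) (x : UnitSphere d) :
    0 < (uniformMeasure d c).real (closedBall x R) := by
  refine ENNReal.toReal_pos ?_ (measure_ne_top _ _)
  have h : (volume : Measure (EuclideanSpace ℝ (Fin d))).toSphere (closedBall x R) ≠ 0 :=
    ((isOpen_ball.measure_pos _ ⟨x, mem_ball_self hR⟩).trans_le
      (measure_mono ball_subset_closedBall)).ne'
  change (c : ENNReal) * _ ≠ 0
  exact mul_ne_zero (by exact_mod_cast hc.ne') h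

variable {c : NNReal} {r rs ρ a : ℝ} {xs : UnitSphere d} {lam : UnitSphere d → ℝ}

/-- One step towards the source. Off the source, the ball about the point at angle `θ` contains a
small ball, of radius `R`, on which the angle is at most `max (θ - 2 * φ(r / 2)) φ(rs)`. -/
theorem IsBallVoltage.mul_le_of_greatCircle
    (h : IsBallVoltage (uniformMeasure d c) r ρ a (closedBall xs rs) lam)
    (hanti : ∀ x x', geoDist xs x ≤ geoDist xs x' → lam x' ≤ lam x) (hr : 0 < r) (hrs : 0 < rs)
    {R : ℝ} (hR : 0 < R) (hRs : arcLength R ≤ arcLength rs)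
    (hRr : 2 * arcLength (r / 2) + 2 * arcLength R ≤ arcLength r)
    {γ : ℝ → UnitSphere d} (hγ0 : γ 0 = xs)
    (hγ : ∀ s t, ⟪(γ s : EuclideanSpace ℝ (Fin d)), γ t⟫ = Real.cos (s - t))
    {θ : ℝ} (hθs : arcLength rs < θ) (hθ : θ ≤ Real.pi) :
    (uniformMeasure d c).real (closedBall xs R) *
      lam (γ (max (θ - 2 * arcLength (r / 2)) (arcLength rs))) ≤ (ρ + a) * lam (γ θ) := by
  have hs0 := arcLength_pos hrs
  have hR0 := arcLength_pos hR
  have hr0 : 0 < arcLength (r / 2) := arcLength_pos (by linarith)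
  have hxs : ∀ θ, 0 ≤ θ → θ ≤ Real.pi → geoDist xs (γ θ) = θ := by
    intro θ h0 h1
    have := geoDist_greatCircle hγ h0 (by linarith)
    rwa [hγ0, sub_zero] at this
  have hout : γ θ ∉ closedBall xs rs := by
    rw [mem_closedBall_iff_geoDist_le hrs.le, hxs θ (by linarith) hθ]
    exact not_le.2 hθs
  rw [h.eq_integral _ hout]
  set θ' := max (θ - 2 * arcLength (r / 2)) (arcLength rs) with hθ'
  have hθ'1 : θ' ≤ Real.pi := max_le (by linarith) (by linarith)
  have hθ'0 : arcLength rs ≤ θ' := le_max_right _ _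
  -- the centre of the small ball lies towards the source, but not beyond its centre
  set ω := min (2 * arcLength (r / 2) + arcLength R) θ with hω
  have hω0 : 0 ≤ ω := le_min (by linarith) (by linarith)
  have hω1 : ω ≤ 2 * arcLength (r / 2) + arcLength R := min_le_left _ _
  have hω2 : ω ≤ θ := min_le_right _ _
  have hωθ : θ - ω + arcLength R ≤ θ' := by
    rcases min_choice (2 * arcLength (r / 2) + arcLength R) θ with h' | h'
    · rw [hω, h']; linarith [le_max_left (θ - 2 * arcLength (r / 2)) (arcLength rs)]
    · rw [hω, h']; linarith
  have hsub : closedBall (γ (θ - ω)) R ⊆ closedBall (γ θ) r := by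
    intro y hy
    rw [mem_closedBall_iff_geoDist_le hR.le] at hy
    rw [mem_closedBall_iff_geoDist_le hr.le]
    have h1 := geoDist_triangle (γ θ) (γ (θ - ω)) y
    rw [geoDist_comm (γ θ) (γ (θ - ω)), geoDist_greatCircle hγ (by linarith) (by linarith)] at h1
    linarith
  have hint : Integrable lam (uniformMeasure d c) := integrable_of_mem_Icc h.measurable h.mem_Icc
  calc (uniformMeasure d c).real (closedBall xs R) * lam (γ θ')
      = ∫ _ in closedBall (γ (θ - ω)) R, lam (γ θ') ∂uniformMeasure d c := by
        rw [setIntegral_const, smul_eq_mul, measure_closedBall_eq c R xs]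
    _ ≤ ∫ y in closedBall (γ (θ - ω)) R, lam y ∂uniformMeasure d c := by
        refine setIntegral_mono_on (integrable_const _).integrableOn hint.integrableOn
          isClosed_closedBall.measurableSet fun y hy ↦ hanti _ _ ?_
        rw [mem_closedBall_iff_geoDist_le hR.le] at hy
        have h1 := geoDist_triangle xs (γ (θ - ω)) y
        rw [hxs (θ - ω) (by linarith) (by linarith)] at h1
        rw [hxs θ' (by linarith) hθ'1]
        linarith
    _ ≤ ∫ y in closedBall (γ θ) r, lam y ∂uniformMeasure d c :=
        setIntegral_mono_set hint.integrableOn (ae_of_all _ fun y ↦ (h.mem_Icc y).1)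
          hsub.eventuallyLE

/-- After `n` steps towards the source, each of which covers twice `φ(r / 2)`. -/
theorem IsBallVoltage.pow_le
    (h : IsBallVoltage (uniformMeasure d c) r ρ a (closedBall xs rs) lam)
    (hanti : ∀ x x', geoDist xs x ≤ geoDist xs x' → lam x' ≤ lam x) (hr : 0 < r) (hrs : 0 < rs)
    {R : ℝ} (hR : 0 < R) (hRs : arcLength R ≤ arcLength rs)
    (hRr : 2 * arcLength (r / 2) + 2 * arcLength R ≤ arcLength r)
    {γ : ℝ → UnitSphere d} (hγ0 : γ 0 = xs)
    (hγ : ∀ s t, ⟪(γ s : EuclideanSpace ℝ (Fin d)), γ t⟫ = Real.cos (s - t))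
    {Γ : ℝ} (hΓ0 : 0 < Γ) (hΓa : Γ ≤ a)
    (hΓ : Γ ≤ (uniformMeasure d c).real (closedBall xs R)) (hρ : 0 < ρ) (n : ℕ) :
    ∀ θ, 0 ≤ θ → θ ≤ Real.pi → θ ≤ arcLength rs + 2 * n * arcLength (r / 2) →
      (Γ / (a + ρ)) ^ n ≤ lam (γ θ) := by
  have hq0 : 0 ≤ Γ / (a + ρ) := div_nonneg hΓ0.le (by linarith)
  have hq1 : Γ / (a + ρ) ≤ 1 := (div_le_one (by linarith)).2 (by linarith)
  have hsrc : ∀ n : ℕ, ∀ θ, 0 ≤ θ → θ ≤ Real.pi → θ ≤ arcLength rs →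
      (Γ / (a + ρ)) ^ n ≤ lam (γ θ) := by
    intro n θ h0 h1 hθ
    have hd := geoDist_greatCircle hγ h0 (by linarith)
    rw [hγ0, sub_zero] at hd
    rw [h.eq_one _ ((mem_closedBall_iff_geoDist_le hrs.le _ _).2 (hd.trans_le hθ))]
    exact pow_le_one₀ hq0 hq1
  induction n with
  | zero => exact fun θ h0 h1 hθ ↦ hsrc 0 θ h0 h1 (by simpa using hθ)
  | succ n ih =>
    intro θ h0 h1 hθ
    rcases le_or_gt θ (arcLength rs) with hs | hs
    · exact hsrc _ θ h0 h1 hs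
    have hr0 : 0 < arcLength (r / 2) := arcLength_pos (by linarith)
    have hs0 := arcLength_pos hrs
    push_cast at hθ
    have hprev := ih (max (θ - 2 * arcLength (r / 2)) (arcLength rs))
      (hs0.le.trans (le_max_right _ _)) (max_le (by linarith) (by linarith))
      (max_le (by linarith) (by have : 0 ≤ 2 * n * arcLength (r / 2) := by positivity
                                linarith))
    have hstep := h.mul_le_of_greatCircle hanti hr hrs hR hRs hRr hγ0 hγ hs h1
    rw [pow_succ', div_mul_eq_mul_div, div_le_iff₀ (by linarith)]
    calc Γ * (Γ / (a + ρ)) ^ n ≤ _ := mul_le_mul hΓ hprev (pow_nonneg hq0 _) measureReal_nonneg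
      _ ≤ _ := hstep
      _ = _ := by ring

theorem exp_neg_mul_log_div_le_pow {m Γ t : ℝ} {n : ℕ} (hΓ : 0 < Γ) (hm : Γ ≤ m) (hn : n ≤ t) :
    Real.exp (-t * Real.log (m / Γ)) ≤ (Γ / m) ^ n := by
  have h0 : 0 < Γ / m := div_pos hΓ (hΓ.trans_le hm)
  rw [← Real.exp_log (pow_pos h0 n), Real.log_pow, ← inv_div Γ m, Real.log_inv, Real.exp_le_exp]
  have : Real.log (Γ / m) ≤ 0 := Real.log_nonpos h0.le ((div_le_one (hΓ.trans_le hm)).2 hm)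
  nlinarith

end LowerBound

end GroundedVoltage

end

/-! ### The voltage on the sphere -/

theorem mainTheorem3 (d : ℕ) (hd : 2 ≤ d) (c : NNReal) (hc : 0 < c)
    (r rs : ℝ) (hr : 0 < r) (hr2 : r ≤ 2) (hrs : 0 < rs) :
    ∃ a : ℝ, 0 < a ∧
      -- `a` is the volume of every ball of radius `r` in the sphere
      (∀ x : GroundedVoltage.UnitSphere d,
        (GroundedVoltage.uniformMeasure d c).real (Metric.closedBall x r) = a) ∧
      ∃ Γ₀ ∈ Set.Ioc 0 a,
        ∀ (xs : GroundedVoltage.UnitSphere d) (ρ : ℝ), 0 < ρ →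
          ∃ lam : GroundedVoltage.UnitSphere d → ℝ,
            -- existence and uniqueness
            GroundedVoltage.IsVoltage d c xs r rs ρ a lam ∧
            (∀ lam' : GroundedVoltage.UnitSphere d → ℝ,
              GroundedVoltage.IsVoltage d c xs r rs ρ a lam' → lam' = lam) ∧
            -- radial symmetry and monotonicity
            ∃ h : ℝ → ℝ,
              (∀ x, lam x = h (GroundedVoltage.geoDist xs x)) ∧
              AntitoneOn h (Set.Icc 0 Real.pi) ∧
              -- upper bound
              (∀ z t : ℝ, 2 * r ≤ z →
                (rs ≤ r ∨ GroundedVoltage.arcLength rs + GroundedVoltage.arcLength r ≤ z) →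
                1 ≤ t → z + t * GroundedVoltage.arcLength r ≤ Real.pi →
                h (z + t * GroundedVoltage.arcLength r) ≤
                  Real.exp (-t * Real.log (1 + 2 * ρ / a))) ∧
              -- lower bound at every distance `z`
              (∃ Γ ∈ Set.Ioc 0 a, ∀ z t : ℝ, 0 ≤ z → 1 ≤ t →
                z + t * GroundedVoltage.arcLength (r / 2) ≤ Real.pi →
                Real.exp (-t * Real.log ((a + ρ) / Γ)) ≤
                  h (z + t * GroundedVoltage.arcLength (r / 2))) ∧
              -- lower bound starting in the source, with a constant independent of `ρ`
              (∀ z t : ℝ, 0 ≤ z → z ≤ GroundedVoltage.arcLength rs → 1 ≤ t →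
                z + t * GroundedVoltage.arcLength (r / 2) ≤ Real.pi →
                Real.exp (-t * Real.log ((a + ρ) / Γ₀)) ≤
                  h (z + t * GroundedVoltage.arcLength (r / 2))) := by
  obtain ⟨x₀⟩ : Nonempty (GroundedVoltage.UnitSphere d) :=
    ⟨⟨EuclideanSpace.single (⟨0, by omega⟩ : Fin d) (1 : ℝ), by simp⟩⟩
  have hs0 := GroundedVoltage.arcLength_pos hrs
  have hsπ : GroundedVoltage.arcLength rs ≤ Real.pi := Real.arccos_le_pi _
  have hr0 : 0 < GroundedVoltage.arcLength (r / 2) := GroundedVoltage.arcLength_pos (by linarith)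
  have hgap := GroundedVoltage.two_mul_arcLength_half_lt hr hr2
  -- the radius of the small balls that are reached by steps of chordal length at most `r`
  obtain ⟨R, hR, hRε⟩ := GroundedVoltage.exists_arcLength_eq
    (ε := min (GroundedVoltage.arcLength rs)
      ((GroundedVoltage.arcLength r - 2 * GroundedVoltage.arcLength (r / 2)) / 2))
    (lt_min hs0 (by linarith)) ((min_le_left _ _).trans hsπ)
  have hRs : GroundedVoltage.arcLength R ≤ GroundedVoltage.arcLength rs :=
    hRε.trans_le (min_le_left _ _)
  have hRr : 2 * GroundedVoltage.arcLength (r / 2) + 2 * GroundedVoltage.arcLength R ≤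
      GroundedVoltage.arcLength r := by
    linarith [hRε.trans_le (min_le_right _ _)]
  set a := (GroundedVoltage.uniformMeasure d c).real (Metric.closedBall x₀ r) with hadef
  have ha : 0 < a := GroundedVoltage.measure_closedBall_pos hc hr x₀
  have hvol : ∀ x : GroundedVoltage.UnitSphere d,
      (GroundedVoltage.uniformMeasure d c).real (Metric.closedBall x r) = a :=
    fun x ↦ GroundedVoltage.measure_closedBall_eq c r x x₀
  set Γ₀ := min a ((GroundedVoltage.uniformMeasure d c).real (Metric.closedBall x₀ R))
  have hΓ₀ : 0 < Γ₀ := lt_min ha (GroundedVoltage.measure_closedBall_pos hc hR x₀)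
  have hΓ₀a : Γ₀ ≤ a := min_le_left _ _
  refine ⟨a, ha, hvol, Γ₀, ⟨hΓ₀, hΓ₀a⟩, fun xs ρ hρ ↦ ?_⟩
  obtain ⟨lam, hlam, hanti⟩ :=
    GroundedVoltage.exists_isBallVoltage_radial c hrs.le hvol ha.le hρ xs
  have hρa : ρ + a ≠ 0 := by linarith
  obtain ⟨γ, hγ0, hγ⟩ := GroundedVoltage.exists_greatCircle hd xs
  have hγd : ∀ θ, 0 ≤ θ → θ ≤ Real.pi → GroundedVoltage.geoDist xs (γ θ) = θ := by
    intro θ h0 h1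
    have := GroundedVoltage.geoDist_greatCircle hγ h0 (by linarith)
    rwa [hγ0, sub_zero] at this
  have hpow := hlam.pow_le hanti hr hrs hR hRs hRr hγ0 hγ hΓ₀ hΓ₀a
    ((min_le_right _ _).trans_eq (GroundedVoltage.measure_closedBall_eq c R x₀ xs)) hρ
  have hq0 : 0 < Γ₀ / (a + ρ) := div_pos hΓ₀ (by linarith)
  have hmono : AntitoneOn (fun θ ↦ lam (γ θ)) (Set.Icc 0 Real.pi) := by
    intro s hs t ht hst
    refine hanti _ _ ?_
    rwa [hγd s hs.1 hs.2, hγd t ht.1 ht.2]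
  refine ⟨lam, (GroundedVoltage.isVoltage_iff_isBallVoltage hρa).2 hlam, fun lam' hlam' ↦
    ((GroundedVoltage.isVoltage_iff_isBallVoltage hρa).1 hlam').unique hlam hvol ha.le hρ,
    fun θ ↦ lam (γ θ), fun x ↦ ?_, hmono, ?_, ?_, ?_⟩
  · have := hγd _ (GroundedVoltage.geoDist_nonneg xs x) (GroundedVoltage.geoDist_le_pi xs x)
    exact le_antisymm (hanti _ _ this.le) (hanti _ _ this.ge)
  · intro z t hz hcase ht hzt
    have hφ := GroundedVoltage.arcLength_pos hr
    obtain ⟨hφ2, hφr⟩ := GroundedVoltage.arcLength_bounds hr hr2 (by nlinarith)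
    have hle := hlam.le_exp_stepCount hr hrs.le hφ2 hvol ha hρ
      (γ (z + t * GroundedVoltage.arcLength r))
    rw [hγd _ (by nlinarith) hzt] at hle
    refine hle.trans (Real.exp_le_exp.2 (mul_le_mul_of_nonneg_right (neg_le_neg
      (GroundedVoltage.le_stepCount_sub hr hφr hrs hz hcase hzt)) (Real.log_nonneg ?_)))
    have : 0 < 2 * ρ / a := by positivity
    linarith
  · have hpos : 0 < lam (γ Real.pi) := by
      obtain ⟨n, hn⟩ := exists_nat_gt (Real.pi / GroundedVoltage.arcLength (r / 2))
      rw [div_lt_iff₀ hr0] at hn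
      have := Real.pi_pos
      exact (pow_pos hq0 n).trans_le (hpow n _ this.le le_rfl (by linarith))
    refine ⟨min a ((a + ρ) * lam (γ Real.pi)), ⟨lt_min ha (by positivity), min_le_left _ _⟩,
      fun z t hz ht hzt ↦ ?_⟩
    have h1 : min a ((a + ρ) * lam (γ Real.pi)) ≤ a + ρ := (min_le_left _ _).trans (by linarith)
    refine (GroundedVoltage.exp_neg_mul_log_div_le_pow (n := 1) (lt_min ha (by positivity)) h1
      (by exact_mod_cast ht)).trans ?_
    rw [pow_one, div_le_iff₀ (by linarith)]
    have h2 : lam (γ Real.pi) ≤ lam (γ (z + t * GroundedVoltage.arcLength (r / 2))) :=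
      hmono ⟨by positivity, hzt⟩ ⟨Real.pi_pos.le, le_rfl⟩ hzt
    refine (min_le_right _ _).trans ?_
    rw [mul_comm]
    exact mul_le_mul_of_nonneg_right h2 (by linarith)
  · intro z t hz hzs ht hzt
    have hfl : (⌊t⌋₊ : ℝ) ≤ t := Nat.floor_le (by linarith)
    have hfl1 : (1 : ℝ) ≤ ⌊t⌋₊ := by exact_mod_cast Nat.le_floor (by exact_mod_cast ht)
    have hfl2 := Nat.lt_floor_add_one t
    refine (GroundedVoltage.exp_neg_mul_log_div_le_pow hΓ₀ (by linarith) hfl).trans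
      (hpow ⌊t⌋₊ _ (by positivity) hzt ?_)
    -- rounding `t ≥ 1` down costs at most a factor two: `t ≤ 2 * ⌊t⌋₊`
    have : t * GroundedVoltage.arcLength (r / 2) ≤
        2 * ⌊t⌋₊ * GroundedVoltage.arcLength (r / 2) :=
      mul_le_mul_of_nonneg_right (by linarith) hr0.le
    linarith
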